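/- Let $n\ge 1$ and let $\Gamma=\{(\alpha_1,\dots,\alpha_n)\in\mathbb{R}^n : 0\le\alpha_n\le\alpha_{n-1}\le\cdots\le\alpha_1\le 1\}$. The $n$-dimensional tent map $T:\Gamma\to\Gamma$ is $$T(\alpha_1,\dots,\alpha_n)=\begin{cases}(\alpha_1+\alpha_n,\ \alpha_1-\alpha_n,\ \dots,\ \alpha_{n-1}-\alpha_n) & \text{if }\alpha_1+\alpha_n\le 1,\\ (2-\alpha_1-\alpha_n,\ \alpha_1-\alpha_n,\ \dots,\ \alpha_{n-1}-\alpha_n) & \text{if }\alpha_1+\alpha_n\ge 1.\end{cases}$$ Let $V$ be the $(n+1)\times(n+1)$ matrix with entries $1$ at the positions $ij$ with $i=n+1$ or ($j\ge 2$ and $i+j\le n+2$), and $0$ elsewhere; its columns are the vertices of $\Gamma$ in projective coordinates $(\alpha_1,\dots,\alpha_n,1)^{tr}$. For $a\in\{0,1\}$ let $B_a$ be the $(n+1)\times(n+1)$ matrix with entry $1$ at position $(a+1,1)$ and at the positions $(j+1,j)$ for $2\le j\le n$, entry $1/2$ at the positions $(1,n+1)$ and $(2,n+1)$, and $0$ elsewhere.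 Let $\tau_a:\Gamma\to\Gamma$ be the affine map induced in projective coordinates by $D_a=VB_aV^{-1}$; the maps $\tau_0,\tau_1$ are the two inverse branches of $T$. For a finite $0$-$1$ word $a_0\dots a_{t-1}$ put $\Gamma_{a_0\dots a_{t-1}}=\tau_{a_0}\cdots\tau_{a_{t-1}}\Gamma$ (this is $\Gamma$ for the empty word). A sequence $\mathbf a\in\{0,1\}^{\mathbb N}$ is a symbolic orbit of $p\in\Gamma$ if $p\in\Gamma_{a_0\dots a_{t-1}}$ for every $t\ge 0$. A sequence $\mathbf c\in\{0,1,*\}^{\mathbb N}$ is a $*$-orbit of $p$ if, for every $t\ge0$, the point $T^tp$ belongs to $\Gamma_0\setminus\Gamma_1$, $\Gamma_1\setminus\Gamma_0$, or $\Gamma_0\cap\Gamma_1$ according to whether $c_t$ is $0$, $1$, or $*$. **Theorem.** Every $p\in\Gamma$ has exactly one $*$-orbit, and this $*$-orbit contains at most $n(n+1)/2$ symbols $*$. Hence every $p\in\Gamma$ has at most $2^{n(n+1)/2}$ symbolic orbits. -/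

import Mathlib

namespace TentMap

noncomputable section

/-- The simplex `Γ` of all points `(α₁, …, αₙ)` with `0 ≤ αₙ ≤ ⋯ ≤ α₁ ≤ 1`; the coordinate `αᵢ` is
the value at the index `i - 1`. -/
def simplex (n : ℕ) : Set (Fin n → ℝ) :=
  {α | (∀ i, 0 ≤ α i ∧ α i ≤ 1) ∧ ∀ i j, i ≤ j → α j ≤ α i}

/-- The last index of `Fin n`, for `n ≥ 1`. -/
def lastIdx (n : ℕ) [NeZero n] : Fin n := Fin.rev 0

/-- The `n`-dimensional tent map: its first coordinate is `α₁ + αₙ` if `α₁ + αₙ ≤ 1` and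
`2 - α₁ - αₙ` otherwise, and its `i`-th coordinate is `αᵢ₋₁ - αₙ` for `2 ≤ i ≤ n`. -/
def tent (n : ℕ) [NeZero n] (α : Fin n → ℝ) : Fin n → ℝ := fun i =>
  if i = 0 then
    if α 0 + α (lastIdx n) ≤ 1 then α 0 + α (lastIdx n) else 2 - α 0 - α (lastIdx n)
  else
    α ⟨i.val - 1, lt_of_le_of_lt (Nat.sub_le _ _) i.isLt⟩ - α (lastIdx n)

/-- The matrix whose columns are the vertices of `Γ` in projective coordinates (indices from `0`). -/
def matV (n : ℕ) : Matrix (Fin (n + 1)) (Fin (n + 1)) ℝ :=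
  Matrix.of fun i j => if i.val = n ∨ (1 ≤ j.val ∧ i.val + j.val ≤ n) then 1 else 0

/-- The matrices `A₀`, `A₁`, with indices from `0`: the entry `1` of the first column is in row `a`,
the last column has entries `1` in its first two rows, and the column `j` in between has entry `1`
in row `j + 1`. -/
def matA (n : ℕ) (a : Fin 2) : Matrix (Fin (n + 1)) (Fin (n + 1)) ℝ :=
  Matrix.of fun i j =>
    if (j.val = 0 ∧ i.val = a.val) ∨ (j.val = n ∧ (i.val = 0 ∨ i.val = 1)) ∨
      (1 ≤ j.val ∧ j.val < n ∧ i.val = j.val + 1) then 1 else 0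

/-- The matrices `B₀`, `B₁`: the last column of `A₀`, `A₁` is halved. -/
def matB (n : ℕ) (a : Fin 2) : Matrix (Fin (n + 1)) (Fin (n + 1)) ℝ :=
  Matrix.of fun i j => if j.val = n then matA n a i j / 2 else matA n a i j

/-- `D_a = V B_a V⁻¹`. -/
def matD (n : ℕ) (a : Fin 2) : Matrix (Fin (n + 1)) (Fin (n + 1)) ℝ :=
  matV n * matB n a * (matV n)⁻¹

/-- The affine map `τ_a` determined by `D_a`: the image of `α` is `β` with
`D_a (α₁, …, αₙ, 1) = (β₁, …, βₙ, 1)`. -/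
def tau (n : ℕ) (a : Fin 2) (α : Fin n → ℝ) : Fin n → ℝ := fun i =>
  (matD n a).mulVec (Fin.snoc α 1 : Fin (n + 1) → ℝ) i.castSucc

/-- The simplex `Γ_w = τ_{a₀} ⋯ τ_{aₜ₋₁} Γ` for the word `w = a₀ ⋯ aₜ₋₁`. -/
def cell (n : ℕ) : List (Fin 2) → Set (Fin n → ℝ)
  | [] => simplex n
  | a :: w => tau n a '' cell n w

/-- The 0-1 sequence `a` is a symbolic orbit of `p` if `p` belongs to `Γ_{a₀ ⋯ aₜ₋₁}` for every `t`,
that is, `p` is the point determined by the decreasing sequence of simplexes `Γ_{a₀ ⋯ aₜ₋₁}`. -/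
def IsSymbolicOrbit (n : ℕ) (p : Fin n → ℝ) (a : ℕ → Fin 2) : Prop :=
  ∀ t : ℕ, p ∈ cell n (List.ofFn fun i : Fin t => a i)

/-- The symbols `0`, `1`, `*`. -/
inductive Symbol : Type
  | zero : Symbol
  | one : Symbol
  | star : Symbol

/-- The set of points of `Γ` coded by a symbol: `Γ₀ \ Γ₁`, `Γ₁ \ Γ₀`, or `Γ₀ ∩ Γ₁`. -/
def region (n : ℕ) : Symbol → Set (Fin n → ℝ)
  | Symbol.zero => cell n [0] \ cell n [1]
  | Symbol.one => cell n [1] \ cell n [0]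
  | Symbol.star => cell n [0] ∩ cell n [1]

/-- `c` is the `*`-orbit of `p` under the tent map. -/
def IsStarOrbit (n : ℕ) [NeZero n] (p : Fin n → ℝ) (c : ℕ → Symbol) : Prop :=
  ∀ t : ℕ, (tent n)^[t] p ∈ region n (c t)

end

end TentMap

/-! Put α₀ = 1 and αₙ₊₁ = 0. Then Γ is the set of decreasing sequences, its facets are the
equalities αᵢ = αᵢ₊₁, and a `*` at time t means that T^t p lies on the face α₁ + αₙ = 1. The task is
to bound the visits to this face. Let F be the number of facets through α and Z its number of zero
coordinates. The map T shifts the facets, and a visit creates the new facet α₁ = 1. If 0 < αₙ and α₁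
< 1, a visit therefore raises F by one. If α₁ = 1 and αₙ = 0, the two end facets merge into one, so
F is unchanged, but Z drops by one. The potential n(n+1) - F(F+1), plus 2Z when α₁ = 1, combines
both effects: it never increases, drops by at least 2 at each visit (`potential_tent_add_le`), and
lies between 0 and n(n+1). Since τ₀ and τ₁ invert T on the two halves of Γ (`tent_tau`, `tau_tent`),
a symbolic orbit is forced at every non-star time, which leaves at most two choices per star. -/

namespace TentMap

/-! ### The inverse branches in coordinates -/

/-- The coordinates of `α` extended by `α₀ = 1` and `αᵢ = 0` for `i > n`. -/
noncomputable def extend (n : ℕ) (α : Fin n → ℝ) (i : ℕ) : ℝ :=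
  if i = 0 then 1 else if h : i - 1 < n then α ⟨i - 1, h⟩ else 0

theorem extend_zero (n : ℕ) (α : Fin n → ℝ) : extend n α 0 = 1 := by simp [extend]

theorem extend_succ (n : ℕ) (α : Fin n → ℝ) (i : Fin n) : extend n α (i + 1) = α i := by
  simp [extend]

theorem extend_succ_of_lt {n : ℕ} (α : Fin n → ℝ) {i : ℕ} (h : i < n) :
    extend n α (i + 1) = α ⟨i, h⟩ := by
  simp [extend, h]

theorem extend_of_lt {n : ℕ} (α : Fin n → ℝ) {i : ℕ} (h : n < i) : extend n α i = 0 := by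
  have h0 : i ≠ 0 := by omega
  have h1 : ¬ i - 1 < n := by omega
  simp [extend, h0, h1]

theorem matV_mulVec_single (n : ℕ) (j i : Fin (n + 1)) :
    (matV n).mulVec (Pi.single j 1) i =
      if i.val = n ∨ (1 ≤ j.val ∧ i.val + j.val ≤ n) then 1 else 0 := by
  simp [matV]

theorem isUnit_matV (n : ℕ) [NeZero n] : IsUnit (matV n) := by
  have hn : 0 < n := Nat.pos_of_ne_zero (NeZero.ne n)
  have key : ∀ i : Fin (n + 1), ∃ w, (matV n).mulVec w = Pi.single i 1 := by
    intro i
    by_cases hi : i.val = n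
    -- Column 0 of V is the vertex at the origin, hence the last basis vector.
    · refine ⟨Pi.single 0 1, ?_⟩
      funext k
      rw [matV_mulVec_single]
      by_cases hk : k = i
      · subst hk; simp [hi]
      · have : k.val ≠ n := fun h => hk (Fin.ext (h.trans hi.symm))
        simp [hk, this]
    · have hi' : i.val < n := by omega
      -- Consecutive vertices differ in one coordinate. For i = 0 the column n + 1 does not exist,
      -- and the origin takes its place.
      refine ⟨Pi.single ⟨n - i.val, by omega⟩ 1 -
        Pi.single ⟨if i.val = 0 then 0 else n - i.val + 1, by split_ifs <;> omega⟩ 1, ?_⟩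
      funext k
      rw [Matrix.mulVec_sub, Pi.sub_apply, matV_mulVec_single, matV_mulVec_single]
      have hk' := k.isLt
      by_cases hk : k = i
      · subst hk
        rw [if_pos (by simp only; omega), if_neg (by simp only; split_ifs <;> omega)]
        simp
      · have hne : k.val ≠ i.val := fun h => hk (Fin.ext h)
        rw [Pi.single_eq_of_ne hk]
        by_cases h1 : k.val = n ∨ k.val < i.val
        · rw [if_pos (by simp only; omega), if_pos (by simp only; split_ifs <;> omega)]
          simp
        · rw [if_neg (by simp only; omega), if_neg (by simp only; split_ifs <;> omega)]
          simp
  choose w hw using key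
  refine (Matrix.isUnit_iff_isUnit_det _).2
    (Matrix.isUnit_det_of_right_inverse (B := Matrix.of fun k i => w i k) ?_)
  ext k i
  have := congrFun (hw i) k
  rw [Matrix.one_apply]
  simp only [Pi.single_apply] at this
  rw [← this]
  rfl

/-- The `i`-th extended coordinate (`i ≥ 1`) of the vertex in the column `j` of `matV n`. -/
def vertexCoord (n j i : ℕ) : ℝ := if 1 ≤ j ∧ i + j ≤ n + 1 then 1 else 0

/-- This is the coordinate formula for τ_a evaluated at the vertices of Γ; the three cases are the
first, last and middle columns of B_a. -/
theorem matV_mul_matB (n : ℕ) [NeZero n] (a : Fin 2) (i : Fin n) (j : Fin (n + 1)) :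
    (matV n * matB n a) i.castSucc j = vertexCoord n j (i + 2) +
      (if a = 0 then vertexCoord n j 1 - vertexCoord n j 2
        else 2 - vertexCoord n j 1 - vertexCoord n j 2) / 2 := by
  have hn : 0 < n := Nat.pos_of_ne_zero (NeZero.ne n)
  have hi := i.isLt
  have hj := j.isLt
  have ha := a.isLt
  rw [Matrix.mul_apply]
  by_cases h0 : j.val = 0
  · have hjn : ¬ j.val = n := by omega
    have hv : ∀ m, vertexCoord n j m = 0 := fun m => if_neg (by omega)
    rw [Finset.sum_eq_single (⟨a.val, by omega⟩ : Fin (n + 1))]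
    · have hB : matB n a ⟨a.val, by omega⟩ j = 1 := by
        simp only [matB, matA, Matrix.of_apply]
        rw [if_neg hjn, if_pos (Or.inl ⟨h0, trivial⟩)]
      simp only [hv, hB, matV, Matrix.of_apply, Fin.val_castSucc]
      have ha2 : a = 0 ∨ a = 1 := by omega
      rcases ha2 with rfl | rfl
      · rw [if_neg (by simp [hi.ne])]
        simp
      · rw [if_pos (Or.inr ⟨le_rfl, hi⟩)]
        simp
    · intro k _ hk
      have hne : k.val ≠ a.val := fun h => hk (Fin.ext h)
      simp only [matB, matA, Matrix.of_apply]
      rw [if_neg hjn, if_neg (by omega), mul_zero]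
    · simp
  by_cases hjn : j.val = n
  · have hB : ∀ k : Fin (n + 1), matB n a k j =
        (if k = 0 then 1 / 2 else 0) + (if k = ⟨1, by omega⟩ then 1 / 2 else 0) := by
      intro k
      by_cases k0 : k.val = 0
      · simp only [matB, matA, Matrix.of_apply, Fin.ext_iff, Fin.val_zero]
        rw [if_pos hjn, if_pos (by omega), if_pos k0, if_neg (by omega), add_zero]
      · simp only [matB, matA, Matrix.of_apply, Fin.ext_iff, Fin.val_zero]
        by_cases k1 : k.val = 1
        · rw [if_pos hjn, if_pos (by omega), if_neg k0, if_pos k1, zero_add]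
        · rw [if_pos hjn, if_neg (by omega), if_neg k0, if_neg k1, zero_div, add_zero]
    simp only [hB, mul_add, Finset.sum_add_distrib, mul_ite, mul_zero, Finset.sum_ite_eq',
      Finset.mem_univ, if_true]
    have e1 : ¬ (i.val + 2 + n ≤ n + 1) := by omega
    have e2 : ¬ (2 + n ≤ n + 1) := by omega
    have e3 : 1 + n ≤ n + 1 := by omega
    have e4 : i.val + 1 ≤ n := by omega
    have e5 : 1 ≤ n := hn
    simp [matV, vertexCoord, hjn, hi.ne, e1, e2, e3, e4, e5]
    split_ifs <;> norm_num
  · rw [Finset.sum_eq_single (⟨j.val + 1, by omega⟩ : Fin (n + 1))]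
    · have e1 : 1 ≤ j.val := by omega
      have e2 : j.val < n := by omega
      have e3 : 1 + j.val ≤ n + 1 := by omega
      have e4 : 2 + j.val ≤ n + 1 := by omega
      have e5 : (i.val + 2 + j.val ≤ n + 1) ↔ (i.val + (j.val + 1) ≤ n) := by omega
      simp [matV, matB, matA, vertexCoord, hjn, e1, e2, e3, e4, e5, hi.ne]
      intro; norm_num
    · intro k _ hk
      have : k.val ≠ j.val + 1 := fun h => hk (Fin.ext h)
      simp only [matB, matA, Matrix.of_apply]
      rw [if_neg hjn, if_neg (by omega), mul_zero]
    · simp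

/-- Both sides are affine in α, so the formula at the vertices extends by barycentric coordinates
`l`. -/
theorem tau_apply (n : ℕ) [NeZero n] (a : Fin 2) (α : Fin n → ℝ) (i : Fin n) :
    tau n a α i = extend n α (i + 2) +
      (if a = 0 then extend n α 1 - extend n α 2
        else 2 - extend n α 1 - extend n α 2) / 2 := by
  have hdet := (Matrix.isUnit_iff_isUnit_det _).1 (isUnit_matV n)
  set x : Fin (n + 1) → ℝ := Fin.snoc α 1 with hx
  set l := (matV n)⁻¹.mulVec x with hl
  have hVl : (matV n).mulVec l = x := by
    rw [hl, Matrix.mulVec_mulVec, Matrix.mul_nonsing_inv _ hdet, Matrix.one_mulVec]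
  have hsum : ∑ j, l j = 1 := by
    have := congrFun hVl (Fin.last n)
    simpa [Matrix.mulVec, dotProduct, matV, hx] using this
  have hext : ∀ k, extend n α (k + 1) = ∑ j : Fin (n + 1), vertexCoord n j (k + 1) * l j := by
    intro k
    by_cases hk : k < n
    · rw [extend_succ_of_lt α hk]
      have := congrFun hVl (Fin.castSucc ⟨k, hk⟩)
      rw [hx, Fin.snoc_castSucc] at this
      rw [← this, Matrix.mulVec, dotProduct]
      refine Finset.sum_congr rfl fun j _ => ?_
      have : (k + 1 + j.val ≤ n + 1) ↔ (k + j.val ≤ n) := by omega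
      simp [matV, vertexCoord, hk.ne, this]
    · rw [extend_of_lt α (by omega)]
      refine (Finset.sum_eq_zero fun j _ => ?_).symm
      rw [vertexCoord, if_neg (by omega), zero_mul]
  have ht : tau n a α i = ∑ j, (matV n * matB n a) i.castSucc j * l j := by
    rw [tau, matD, ← Matrix.mulVec_mulVec]
    rfl
  rw [ht, hext (i + 1), hext 0, hext 1]
  simp only [matV_mul_matB]
  split_ifs
  · rw [← Finset.sum_sub_distrib, Finset.sum_div, ← Finset.sum_add_distrib]
    exact Finset.sum_congr rfl fun j _ => by ring
  -- The constant 2 is homogenized, since barycentric coordinates sum to 1.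
  · have h2 : ∀ y z : ℝ, 2 - y - z = ∑ j, 2 * l j - y - z := by
      rw [← Finset.mul_sum, hsum, mul_one]
      exact fun _ _ => rfl
    rw [h2, ← Finset.sum_sub_distrib, ← Finset.sum_sub_distrib,
      Finset.sum_div, ← Finset.sum_add_distrib]
    exact Finset.sum_congr rfl fun j _ => by ring

/-! ### The tent map in coordinates -/

theorem extend_self (n : ℕ) [NeZero n] (α : Fin n → ℝ) : extend n α n = α (lastIdx n) := by
  obtain ⟨k, rfl⟩ := Nat.exists_eq_succ_of_ne_zero (NeZero.ne n)
  rw [extend_succ_of_lt α (Nat.lt_succ_self k)]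
  congr 1

theorem extend_one (n : ℕ) [NeZero n] (α : Fin n → ℝ) : extend n α 1 = α 0 :=
  extend_succ n α 0

theorem extend_tent_one (n : ℕ) [NeZero n] (α : Fin n → ℝ) :
    extend n (tent n α) 1 = if extend n α 1 + extend n α n ≤ 1 then
      extend n α 1 + extend n α n else 2 - extend n α 1 - extend n α n := by
  simp only [extend_one, extend_self]
  simp [tent]

/-- The case i = n is included: both sides are 0 there, so the convention αₙ₊₁ = 0 is compatible
with the shift. -/
theorem extend_tent_succ (n : ℕ) [NeZero n] (α : Fin n → ℝ) {i : ℕ} (h1 : 1 ≤ i) (hi : i ≤ n) :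
    extend n (tent n α) (i + 1) = extend n α i - extend n α n := by
  obtain ⟨k, rfl⟩ := Nat.exists_eq_succ_of_ne_zero (Nat.one_le_iff_ne_zero.1 h1)
  rcases hi.lt_or_eq with h | h
  · rw [extend_succ_of_lt _ h, extend_self, extend_succ_of_lt α (Nat.lt_of_succ_lt h)]
    simp [tent, Fin.ext_iff]
  · rw [extend_of_lt _ (by omega), h, sub_self]

theorem mem_simplex_iff {n : ℕ} {α : Fin n → ℝ} :
    α ∈ simplex n ↔ Antitone (extend n α) := by
  constructor
  · rintro ⟨h1, h2⟩
    refine antitone_nat_of_succ_le fun i => ?_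
    rcases i with _ | i
    · rw [extend_zero]
      by_cases h : 0 < n
      · rw [extend_succ_of_lt α h]; exact (h1 _).2
      · rw [extend_of_lt α (by omega)]; exact zero_le_one
    · by_cases h : i + 1 < n
      · rw [extend_succ_of_lt α h, extend_succ_of_lt α (Nat.lt_of_succ_lt h)]
        exact h2 _ _ (Fin.mk_le_mk.2 (Nat.le_succ i))
      · rw [extend_of_lt α (i := i + 1 + 1) (by omega)]
        by_cases h' : i < n
        · rw [extend_succ_of_lt α h']; exact (h1 _).1
        · rw [extend_of_lt α (by omega)]
  · intro h
    refine ⟨fun i => ⟨?_, ?_⟩, fun i j hij => ?_⟩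
    · rw [← extend_succ n α i, ← extend_of_lt α (Nat.lt_succ_self n)]
      exact h (by omega)
    · rw [← extend_succ n α i, ← extend_zero n α]
      exact h (Nat.zero_le _)
    · rw [← extend_succ n α i, ← extend_succ n α j]
      exact h (Nat.succ_le_succ hij)

theorem ext_of_extend {n : ℕ} {α β : Fin n → ℝ}
    (h : ∀ i, 1 ≤ i → i ≤ n → extend n α i = extend n β i) : α = β := by
  funext i
  rw [← extend_succ n α i, ← extend_succ n β i]
  exact h _ (by omega) (by omega)

theorem extend_nonneg {n : ℕ} {α : Fin n → ℝ} (h : α ∈ simplex n) (i : ℕ) : 0 ≤ extend n α i := by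
  rw [← extend_of_lt α (i := max i (n + 1)) (by omega)]
  exact mem_simplex_iff.1 h (le_max_left _ _)

theorem extend_le_one {n : ℕ} {α : Fin n → ℝ} (h : α ∈ simplex n) (i : ℕ) : extend n α i ≤ 1 := by
  rw [← extend_zero n α]
  exact mem_simplex_iff.1 h (Nat.zero_le _)

theorem tent_mem_simplex {n : ℕ} [NeZero n] {α : Fin n → ℝ} (h : α ∈ simplex n) :
    tent n α ∈ simplex n := by
  have hn : 1 ≤ n := Nat.one_le_iff_ne_zero.2 (NeZero.ne n)
  have hmono := mem_simplex_iff.1 h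
  refine mem_simplex_iff.2 (antitone_nat_of_succ_le fun i => ?_)
  rcases i with _ | _ | i
  · rw [extend_zero, extend_tent_one]
    split_ifs <;> linarith
  · rw [extend_tent_succ n α le_rfl hn, extend_tent_one]
    have := extend_nonneg h n
    have := extend_le_one h 1
    split_ifs <;> linarith
  · rcases lt_or_ge n (i + 2) with h' | h'
    · rw [extend_of_lt _ (by omega)]
      rcases lt_or_ge n (i + 1) with h2 | h2
      · rw [extend_of_lt _ (by omega)]
      · rw [extend_tent_succ n α (by omega) h2]
        exact sub_nonneg.2 (hmono h2)
    · rw [extend_tent_succ n α (by omega) h', extend_tent_succ n α (by omega) (by omega)]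
      exact sub_le_sub_right (hmono (Nat.le_succ _)) _

/-! ### The maps τ_a as inverses of the tent map -/

/-- The last coordinate of `τ_a α`. -/
noncomputable def tauLast (n : ℕ) (a : Fin 2) (α : Fin n → ℝ) : ℝ :=
  (if a = 0 then extend n α 1 - extend n α 2 else 2 - extend n α 1 - extend n α 2) / 2

theorem extend_tau (n : ℕ) [NeZero n] (a : Fin 2) (α : Fin n → ℝ) {i : ℕ} (h1 : 1 ≤ i)
    (hi : i ≤ n) : extend n (tau n a α) i = extend n α (i + 1) + tauLast n a α := by
  obtain ⟨k, rfl⟩ := Nat.exists_eq_succ_of_ne_zero (Nat.one_le_iff_ne_zero.1 h1)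
  rw [extend_succ_of_lt _ hi, tau_apply]
  rfl

theorem extend_tau_self (n : ℕ) [NeZero n] (a : Fin 2) (α : Fin n → ℝ) :
    extend n (tau n a α) n = tauLast n a α := by
  rw [extend_tau n a α (Nat.one_le_iff_ne_zero.2 (NeZero.ne n)) le_rfl,
    extend_of_lt α (Nat.lt_succ_self n), zero_add]

/-- The half of `ℝⁿ` on which the tent map is inverted by `τ_a`. -/
def half (n : ℕ) (a : Fin 2) : Set (Fin n → ℝ) :=
  {α | if a = 0 then extend n α 1 + extend n α n ≤ 1 else 1 ≤ extend n α 1 + extend n α n}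

theorem tau_mem_half {n : ℕ} [NeZero n] {a : Fin 2} {α : Fin n → ℝ} (h : α ∈ simplex n) :
    tau n a α ∈ half n a := by
  have hn : 1 ≤ n := Nat.one_le_iff_ne_zero.2 (NeZero.ne n)
  have h1 := extend_le_one h 1
  simp only [half, Set.mem_ofPred_eq]
  rw [extend_tau_self, extend_tau n a α le_rfl hn, tauLast]
  split_ifs <;> linarith

theorem tau_mem_simplex {n : ℕ} [NeZero n] {a : Fin 2} {α : Fin n → ℝ} (h : α ∈ simplex n) :
    tau n a α ∈ simplex n := by
  have hn : 1 ≤ n := Nat.one_le_iff_ne_zero.2 (NeZero.ne n)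
  have hmono := mem_simplex_iff.1 h
  have h0 := extend_nonneg h 2
  have h1 := extend_le_one h 1
  have h2 : extend n α 2 ≤ extend n α 1 := hmono (by norm_num)
  refine mem_simplex_iff.2 (antitone_nat_of_succ_le fun i => ?_)
  rcases i with _ | i
  · rw [extend_zero, extend_tau n a α le_rfl hn, tauLast]
    split_ifs <;> linarith
  · rcases lt_or_ge n (i + 2) with h' | h'
    · rw [extend_of_lt _ h']
      rcases lt_or_ge n (i + 1) with h3 | h3
      · rw [extend_of_lt _ h3]
      · rw [extend_tau n a α (by omega) h3, tauLast]
        have := extend_nonneg h (i + 1 + 1)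
        split_ifs <;> linarith
    · rw [extend_tau n a α (by omega) h', extend_tau n a α (by omega) (by omega)]
      exact add_le_add_left (hmono (Nat.le_succ _)) _

theorem tent_tau {n : ℕ} [NeZero n] {a : Fin 2} {α : Fin n → ℝ} (h : α ∈ simplex n) :
    tent n (tau n a α) = α := by
  have hn : 1 ≤ n := Nat.one_le_iff_ne_zero.2 (NeZero.ne n)
  refine ext_of_extend fun i h1 hi => ?_
  obtain ⟨k, rfl⟩ := Nat.exists_eq_succ_of_ne_zero (Nat.one_le_iff_ne_zero.1 h1)
  rcases k with _ | k
  · have h1 := extend_le_one h 1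
    rw [extend_tent_one, extend_tau_self, extend_tau n a α le_rfl hn, tauLast]
    split_ifs <;> linarith
  · rw [extend_tent_succ n _ (by omega) (by omega), extend_tau_self,
      extend_tau n a α (by omega) (by omega)]
    ring

theorem tau_tent {n : ℕ} [NeZero n] {a : Fin 2} {α : Fin n → ℝ} (h : α ∈ half n a) :
    tau n a (tent n α) = α := by
  have hn : 1 ≤ n := Nat.one_le_iff_ne_zero.2 (NeZero.ne n)
  have hlast : tauLast n a (tent n α) = extend n α n := by
    simp only [half, Set.mem_ofPred_eq] at h
    rw [tauLast, extend_tent_one, extend_tent_succ n α le_rfl hn]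
    split_ifs at h ⊢ <;> linarith
  refine ext_of_extend fun i h1 hi => ?_
  rw [extend_tau n a _ h1 hi, hlast, extend_tent_succ n α h1 hi]
  ring

/-! ### Symbolic orbits and itineraries -/

theorem cell_subset_simplex (n : ℕ) [NeZero n] (w : List (Fin 2)) : cell n w ⊆ simplex n := by
  induction w with
  | nil => exact subset_rfl
  | cons a w ih =>
    rintro _ ⟨q, hq, rfl⟩
    exact tau_mem_simplex (ih hq)

theorem mem_cell_cons {n : ℕ} [NeZero n] {a : Fin 2} {w : List (Fin 2)} {p : Fin n → ℝ} :
    p ∈ cell n (a :: w) ↔ p ∈ half n a ∧ p ∈ simplex n ∧ tent n p ∈ cell n w := by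
  constructor
  · rintro ⟨q, hq, rfl⟩
    have hs := cell_subset_simplex n w hq
    exact ⟨tau_mem_half hs, tau_mem_simplex hs, by rwa [tent_tau hs]⟩
  · rintro ⟨h, -, hw⟩
    exact ⟨tent n p, hw, tau_tent h⟩

theorem mem_cell_singleton {n : ℕ} [NeZero n] {a : Fin 2} {p : Fin n → ℝ} (hp : p ∈ simplex n) :
    p ∈ cell n [a] ↔ p ∈ half n a := by
  rw [mem_cell_cons]
  exact ⟨fun h => h.1, fun h => ⟨h, hp, tent_mem_simplex hp⟩⟩

theorem iterate_tent_mem_simplex {n : ℕ} [NeZero n] {p : Fin n → ℝ} (hp : p ∈ simplex n) (t : ℕ) :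
    (tent n)^[t] p ∈ simplex n := by
  induction t with
  | zero => exact hp
  | succ t ih =>
    rw [Function.iterate_succ_apply']
    exact tent_mem_simplex ih

theorem iterate_mem_half {n : ℕ} [NeZero n] {t : ℕ} : ∀ {p : Fin n → ℝ} {a : ℕ → Fin 2},
    p ∈ cell n (List.ofFn fun i : Fin (t + 1) => a i) → (tent n)^[t] p ∈ half n (a t) := by
  induction t with
  | zero =>
    intro p a h
    rw [List.ofFn_succ] at h
    exact (mem_cell_cons.1 h).1
  | succ t ih =>
    intro p a h
    rw [List.ofFn_succ] at h
    rw [Function.iterate_succ_apply]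
    -- Applying T to the point shifts the sequence.
    exact ih (a := fun i => a (i + 1)) (by simpa using (mem_cell_cons.1 h).2.2)

theorem mem_half_zero {n : ℕ} {α : Fin n → ℝ} :
    α ∈ half n 0 ↔ extend n α 1 + extend n α n ≤ 1 := by simp [half]

theorem mem_half_one {n : ℕ} {α : Fin n → ℝ} :
    α ∈ half n 1 ↔ 1 ≤ extend n α 1 + extend n α n := by simp [half]

theorem existsUnique_mem_region {n : ℕ} [NeZero n] {p : Fin n → ℝ} (hp : p ∈ simplex n) :
    ∃! s, p ∈ region n s := by
  have h0 : p ∈ cell n [0] ↔ _ := (mem_cell_singleton hp).trans mem_half_zero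
  have h1 : p ∈ cell n [1] ↔ _ := (mem_cell_singleton hp).trans mem_half_one
  by_cases c0 : p ∈ cell n [0] <;> by_cases c1 : p ∈ cell n [1]
  · exact ⟨.star, ⟨c0, c1⟩, fun s hs => by cases s <;> simp_all [region]⟩
  · exact ⟨.zero, ⟨c0, c1⟩, fun s hs => by cases s <;> simp_all [region]⟩
  · exact ⟨.one, ⟨c1, c0⟩, fun s hs => by cases s <;> simp_all [region]⟩
  · rw [h0] at c0
    rw [h1] at c1
    exact absurd (le_of_not_ge c0) c1

theorem mem_region_star {n : ℕ} [NeZero n] {p : Fin n → ℝ} (hp : p ∈ simplex n) :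
    p ∈ region n .star ↔ extend n p 1 + extend n p n = 1 := by
  rw [region, Set.mem_inter_iff, mem_cell_singleton hp, mem_cell_singleton hp, mem_half_zero,
    mem_half_one]
  exact ⟨fun h => le_antisymm h.1 h.2, fun h => ⟨h.le, h.ge⟩⟩

/-- Two symbolic orbits of `p` can differ only at the times at which the orbit of `p` meets the
common face of `Γ₀` and `Γ₁`. -/
theorem IsSymbolicOrbit.eq_of_ne_star {n : ℕ} [NeZero n] {p : Fin n → ℝ} (hp : p ∈ simplex n)
    {a b : ℕ → Fin 2} (ha : IsSymbolicOrbit n p a) (hb : IsSymbolicOrbit n p b)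
    {c : ℕ → Symbol} (hc : IsStarOrbit n p c) {t : ℕ} (ht : c t ≠ .star) : a t = b t := by
  have hs := iterate_tent_mem_simplex hp t
  have h1 := iterate_mem_half (ha (t + 1))
  have h2 := iterate_mem_half (hb (t + 1))
  have key : ¬ ((tent n)^[t] p ∈ half n 0 ∧ (tent n)^[t] p ∈ half n 1) := by
    rw [← mem_cell_singleton hs, ← mem_cell_singleton hs]
    intro h
    exact ht ((existsUnique_mem_region hs).unique (hc t) h)
  generalize a t = u at *
  generalize b t = v at *
  fin_cases u <;> fin_cases v
  · rfl
  · exact absurd ⟨h1, h2⟩ key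
  · exact absurd ⟨h2, h1⟩ key
  · rfl

/-! ### Counting the visits to the common face -/

/-- The number of facets of `Γ` that contain `α`. -/
noncomputable def facetCount (n : ℕ) (α : Fin n → ℝ) : ℤ :=
  ∑ i ∈ Finset.range (n + 1), if extend n α i = extend n α (i + 1) then 1 else 0

/-- The number of coordinates of `α` equal to zero. -/
noncomputable def zeroCount (n : ℕ) (α : Fin n → ℝ) : ℤ :=
  ∑ i ∈ Finset.range n, if extend n α (i + 1) = 0 then 1 else 0

/-- Twice a bound for the number of visits of the orbit of `α` to the common face. -/
noncomputable def potential (n : ℕ) (α : Fin n → ℝ) : ℤ :=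
  n * (n + 1) - facetCount n α * (facetCount n α + 1) +
    if extend n α 1 = 1 then 2 * zeroCount n α else 0

theorem zeroCount_nonneg (n : ℕ) (α : Fin n → ℝ) : 0 ≤ zeroCount n α :=
  Finset.sum_nonneg fun i _ => by split_ifs <;> norm_num

theorem facetCount_nonneg (n : ℕ) (α : Fin n → ℝ) : 0 ≤ facetCount n α :=
  Finset.sum_nonneg fun i _ => by split_ifs <;> norm_num

/-- A point on all n + 1 facets would give 1 = α₀ = αₙ₊₁ = 0. -/
theorem facetCount_le (n : ℕ) (α : Fin n → ℝ) : facetCount n α ≤ n := by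
  by_contra hlt
  have hall : ∀ i ∈ Finset.range (n + 1), extend n α i = extend n α (i + 1) := by
    by_contra! hne
    obtain ⟨i, hi, hne⟩ := hne
    have : facetCount n α < ∑ _i ∈ Finset.range (n + 1), (1 : ℤ) :=
      Finset.sum_lt_sum (fun j _ => by split_ifs <;> norm_num) ⟨i, hi, by simp [hne]⟩
    simp at this
    omega
  have hone : ∀ i, i ≤ n + 1 → extend n α i = 1 := by
    intro i
    induction i with
    | zero => intro _; exact extend_zero n α
    | succ i ih =>
      intro hi
      rw [← hall i (Finset.mem_range.2 hi)]
      exact ih (by omega)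
  have := hone (n + 1) le_rfl
  rw [extend_of_lt α (Nat.lt_succ_self n)] at this
  exact zero_ne_one this

/-- Each zero αᵢ forces αᵢ = αᵢ₊₁, and the facet α₀ = α₁ is an additional one. -/
theorem zeroCount_lt_facetCount {n : ℕ} {α : Fin n → ℝ} (h : α ∈ simplex n)
    (h1 : extend n α 1 = 1) : zeroCount n α + 1 ≤ facetCount n α := by
  rw [facetCount, Finset.sum_range_succ', zero_add, h1, extend_zero, if_pos rfl, zeroCount]
  refine add_le_add_left (Finset.sum_le_sum fun i _ => ?_) 1
  by_cases h0 : extend n α (i + 1) = 0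
  · have h2 : extend n α (i + 1 + 1) = 0 :=
      le_antisymm (h0 ▸ mem_simplex_iff.1 h (Nat.le_succ _)) (extend_nonneg h _)
    simp [h0, h2]
  · rw [if_neg h0]
    split_ifs <;> norm_num

theorem potential_nonneg (n : ℕ) (α : Fin n → ℝ) : 0 ≤ potential n α := by
  have h0 := facetCount_nonneg n α
  have h1 := facetCount_le n α
  have h2 := zeroCount_nonneg n α
  rw [potential]
  split_ifs <;> nlinarith

theorem potential_le {n : ℕ} {α : Fin n → ℝ} (h : α ∈ simplex n) :
    potential n α ≤ n * (n + 1) := by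
  have h0 := facetCount_nonneg n α
  rw [potential]
  split_ifs with h1
  · have h2 := zeroCount_lt_facetCount h h1
    have h3 := mul_nonneg h0 (by linarith [zeroCount_nonneg n α] : 0 ≤ facetCount n α - 1)
    nlinarith
  · nlinarith

/-- The facets containing `α` are shifted by the tent map, and the face `α₁ + αₙ = 1` is mapped
to the facet `α₁ = 1`. -/
theorem facetCount_tent {n : ℕ} [NeZero n] {α : Fin n → ℝ} (h : α ∈ simplex n) :
    facetCount n (tent n α) = facetCount n α
      + (if extend n α 1 + extend n α n = 1 then 1 else 0)
      + (if extend n α 1 = 1 ∨ extend n α n = 0 then 1 else 0)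
      - (if extend n α 1 = 1 then 1 else 0) - (if extend n α n = 0 then 1 else 0) := by
  have hlast' : extend n α (n + 1) = 0 := extend_of_lt α (Nat.lt_succ_self n)
  have hn : 1 ≤ n := Nat.one_le_iff_ne_zero.2 (NeZero.ne n)
  have e0 : extend n (tent n α) 1 = 1 ↔ extend n α 1 + extend n α n = 1 := by
    rw [extend_tent_one]
    split_ifs <;> constructor <;> intro <;> linarith
  -- The branch α₁ + αₙ ≤ 1 gives αₙ = 0, the other gives α₁ = 1; so the two end facets have the
  -- same image facet.
  have e1 : extend n (tent n α) 1 = extend n (tent n α) 2 ↔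
      extend n α 1 = 1 ∨ extend n α n = 0 := by
    have := extend_le_one h 1
    have := extend_nonneg h n
    rw [extend_tent_one, extend_tent_succ n α le_rfl hn]
    split_ifs with hc
    · constructor
      · intro; right; linarith
      · rintro (h | h) <;> linarith
    · constructor
      · intro; left; linarith
      · rintro (h | h) <;> linarith
  obtain ⟨k, hk⟩ := Nat.exists_eq_succ_of_ne_zero (NeZero.ne n)
  have e2 : ∀ i ∈ Finset.range k,
      (if extend n (tent n α) (i + 1 + 1) = extend n (tent n α) (i + 1 + 1 + 1) then (1 : ℤ) else 0)
        = if extend n α (i + 1) = extend n α (i + 1 + 1) then 1 else 0 := by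
    intro i hi
    have := Finset.mem_range.1 hi
    rw [extend_tent_succ n α (by omega) (by omega), extend_tent_succ n α (by omega) (by omega)]
    simp only [sub_left_inj]
  have hr : n + 1 = k + 1 + 1 := by omega
  have hk1 : k + 1 = n := hk.symm
  rw [facetCount, facetCount, hr, Finset.sum_range_succ', Finset.sum_range_succ',
    Finset.sum_congr rfl e2, Finset.sum_range_succ, Finset.sum_range_succ', hk1]
  simp only [zero_add, Nat.reduceAdd, e0, e1, hlast', extend_zero, eq_comm (a := (1 : ℝ))]
  ring

/-- Here T is a pure shift: a 1 enters in front and the last zero leaves. -/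
theorem zeroCount_tent {n : ℕ} [NeZero n] {α : Fin n → ℝ} (h1 : extend n α 1 = 1)
    (hn0 : extend n α n = 0) : zeroCount n (tent n α) + 1 = zeroCount n α := by
  obtain ⟨k, hk⟩ := Nat.exists_eq_succ_of_ne_zero (NeZero.ne n)
  have e2 : ∀ i ∈ Finset.range k,
      (if extend n (tent n α) (i + 1 + 1) = 0 then (1 : ℤ) else 0)
        = if extend n α (i + 1) = 0 then 1 else 0 := by
    intro i hi
    have := Finset.mem_range.1 hi
    rw [extend_tent_succ n α (by omega) (by omega), hn0, sub_zero]
  have e1 : extend n (tent n α) (0 + 1) = 1 := by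
    rw [extend_tent_one, h1, hn0]; norm_num
  have hr : ∀ β, zeroCount n β =
      ∑ i ∈ Finset.range (k + 1), if extend n β (i + 1) = 0 then 1 else 0 := by
    intro β; rw [zeroCount, ← Nat.succ_eq_add_one k, ← hk]
  have hk1 : k + 1 = n := hk.symm
  rw [hr, hr, Finset.sum_range_succ', Finset.sum_congr rfl e2, Finset.sum_range_succ, hk1, hn0, e1]
  simp

theorem potential_tent_add_le {n : ℕ} [NeZero n] {α : Fin n → ℝ} (h : α ∈ simplex n) :
    potential n (tent n α) + (if extend n α 1 + extend n α n = 1 then 2 else 0)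
      ≤ potential n α := by
  have hf := facetCount_tent h
  have hT : extend n (tent n α) 1 = 1 ↔ extend n α 1 + extend n α n = 1 := by
    rw [extend_tent_one]
    split_ifs <;> constructor <;> intro <;> linarith
  have hz := zeroCount_nonneg n α
  by_cases h1 : extend n α 1 = 1
  · by_cases h0 : extend n α n = 0
    · have hs := zeroCount_tent h1 h0
      simp only [potential, hT, hf, h1, h0]
      simp
      linarith
    -- No visit: F is unchanged and the nonnegative term 2Z is lost.
    · simp only [potential, hT, hf, h1]
      simp [h0, hz]
  · by_cases h0 : extend n α n = 0
    · simp only [potential, hT, hf, h0]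
      simp [h1]
    · by_cases hw : extend n α 1 + extend n α n = 1
      -- Now F grows by one, costing 2(F + 1), while the new term 2Z' is at most 2F: a net drop of
      -- at least 2.
      · have hb := zeroCount_lt_facetCount (tent_mem_simplex h) (hT.2 hw)
        simp only [h1, h0, hw] at hf
        simp only [potential, hT, hw, if_true, h1, if_false]
        simp at hf
        rw [hf] at hb ⊢
        linarith
      · simp only [potential, hT, hf]
        simp [h1, h0, hw]

theorem two_mul_card_visits_le {n : ℕ} [NeZero n] {p : Fin n → ℝ} (hp : p ∈ simplex n) (N : ℕ) :
    potential n ((tent n)^[N] p) + ∑ t ∈ Finset.range N,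
      (if extend n ((tent n)^[t] p) 1 + extend n ((tent n)^[t] p) n = 1 then (2 : ℤ) else 0)
      ≤ n * (n + 1) := by
  induction N with
  | zero => simpa using potential_le hp
  | succ N ih =>
    have := potential_tent_add_le (iterate_tent_mem_simplex hp N)
    rw [Finset.sum_range_succ, Function.iterate_succ_apply']
    linarith

theorem encard_visits_le {n : ℕ} [NeZero n] {p : Fin n → ℝ} (hp : p ∈ simplex n) :
    {t : ℕ | extend n ((tent n)^[t] p) 1 + extend n ((tent n)^[t] p) n = 1}.encard
      ≤ ((n * (n + 1) / 2 : ℕ) : ℕ∞) := by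
  by_contra! hlt
  -- A finite set with one visit too many lies below some time N, which covers the infinite case
  -- too.
  obtain ⟨s, hs, hcard⟩ := Set.exists_subset_encard_eq (Order.add_one_le_of_lt hlt)
  have hfin : s.Finite := Set.finite_of_encard_eq_coe (k := n * (n + 1) / 2 + 1) (by simpa using hcard)
  lift s to Finset ℕ using hfin
  have hc : s.card = n * (n + 1) / 2 + 1 := by
    rw [Set.encard_coe_eq_coe_finsetCard] at hcard
    exact_mod_cast hcard
  obtain ⟨N, hN⟩ := s.exists_nat_subset_range
  have h1 := two_mul_card_visits_le hp N
  have h2 := potential_nonneg n ((tent n)^[N] p)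
  have h3 : ∑ t ∈ s, (2 : ℤ) ≤ ∑ t ∈ Finset.range N,
      (if extend n ((tent n)^[t] p) 1 + extend n ((tent n)^[t] p) n = 1 then (2 : ℤ) else 0) := by
    refine (Finset.sum_congr rfl fun t ht => ?_).trans_le (Finset.sum_le_sum_of_subset_of_nonneg hN
      fun t _ _ => by split_ifs <;> norm_num)
    exact (if_pos (hs ht)).symm
  rw [Finset.sum_const, hc, nsmul_eq_mul] at h3
  have h4 : ((n * (n + 1) : ℕ) : ℤ) < ((n * (n + 1) / 2 + 1 : ℕ) : ℤ) * 2 := by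
    exact_mod_cast (by omega : n * (n + 1) < (n * (n + 1) / 2 + 1) * 2)
  push_cast at h3 h4
  linarith

/-! ### From visits to stars and symbolic orbits -/

theorem encard_stars_le {n : ℕ} [NeZero n] {p : Fin n → ℝ} (hp : p ∈ simplex n)
    {c : ℕ → Symbol} (hc : IsStarOrbit n p c) :
    {t : ℕ | c t = Symbol.star}.encard ≤ ((n * (n + 1) / 2 : ℕ) : ℕ∞) := by
  refine (Set.encard_le_encard fun t ht => ?_).trans (encard_visits_le hp)
  have := hc t
  rw [Set.mem_ofPred_eq] at ht
  rw [ht] at this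
  exact (mem_region_star (iterate_tent_mem_simplex hp t)).1 this

theorem existsUnique_isStarOrbit {n : ℕ} [NeZero n] {p : Fin n → ℝ} (hp : p ∈ simplex n) :
    ∃! c : ℕ → Symbol, IsStarOrbit n p c := by
  have h := fun t => existsUnique_mem_region (iterate_tent_mem_simplex hp t)
  choose c hc hu using h
  exact ⟨c, hc, fun d hd => funext fun t => hu t _ (hd t)⟩

theorem encard_symbolicOrbits_le {n : ℕ} [NeZero n] {p : Fin n → ℝ} (hp : p ∈ simplex n) :
    {a : ℕ → Fin 2 | IsSymbolicOrbit n p a}.encard ≤ ((2 ^ (n * (n + 1) / 2) : ℕ) : ℕ∞) := by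
  obtain ⟨c, hc, -⟩ := existsUnique_isStarOrbit hp
  have hle := encard_stars_le hp hc
  have hfin : {t : ℕ | c t = Symbol.star}.Finite := Set.finite_of_encard_le_coe hle
  have : Finite {t : ℕ | c t = Symbol.star} := hfin
  -- Restriction to the star times loses nothing, as all symbolic orbits agree elsewhere.
  let f : {a : ℕ → Fin 2 | IsSymbolicOrbit n p a} → ({t : ℕ | c t = Symbol.star} → Fin 2) :=
    fun a t => a.1 t
  have hf : Function.Injective f := by
    intro a b hab
    refine Subtype.ext (funext fun t => ?_)
    by_cases ht : c t = Symbol.star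
    · exact congrFun hab ⟨t, ht⟩
    · exact a.2.eq_of_ne_star hp b.2 hc ht
  have : Finite {a : ℕ → Fin 2 | IsSymbolicOrbit n p a} := Finite.of_injective f hf
  have hcard := Nat.card_le_card_of_injective f hf
  rw [Nat.card_fun, Nat.card_fin, Nat.card_coe_set_eq, Nat.card_coe_set_eq] at hcard
  rw [← Set.Finite.cast_ncard_eq (Set.toFinite _)]
  rw [← hfin.cast_ncard_eq] at hle
  have hle' := Nat.cast_le.1 hle
  exact_mod_cast hcard.trans (Nat.pow_le_pow_right (by norm_num) hle')

end TentMap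

theorem mainTheorem6 (n : ℕ) [NeZero n] (p : Fin n → ℝ) (hp : p ∈ TentMap.simplex n) :
    (∃! c : ℕ → TentMap.Symbol, TentMap.IsStarOrbit n p c) ∧
    (∀ c : ℕ → TentMap.Symbol, TentMap.IsStarOrbit n p c →
      {t : ℕ | c t = TentMap.Symbol.star}.encard ≤ ((n * (n + 1) / 2 : ℕ) : ℕ∞)) ∧
    {a : ℕ → Fin 2 | TentMap.IsSymbolicOrbit n p a}.encard
      ≤ ((2 ^ (n * (n + 1) / 2) : ℕ) : ℕ∞) :=
  ⟨TentMap.existsUnique_isStarOrbit hp, fun _ hc => TentMap.encard_stars_le hp hc,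
    TentMap.encard_symbolicOrbits_le hp⟩
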